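/- Let $d\ge 1$ and let $\mu:\mathbb R\to(0,\infty)$ be a differentiable growth rate, i.e. differentiable and strictly increasing with $\mu(0)=1$, $\mu(t)\to\infty$ as $t\to\infty$ and $\mu(t)\to 0$ as $t\to-\infty$. All systems below are linear systems $y'=A(t)y$ on $\mathbb R^d$ with locally integrable $A:\mathbb R\to\mathbb R^{d\times d}$; solutions are understood in the Carathéodory sense, and $\Phi_A(t,s)$ denotes the evolution operator. Definitions. * For $\epsilon\ge 0$, $A$ has $(\mathrm N\mu,\epsilon)$-growth if there are $K\ge 1$, $a\ge 0$ with $\|\Phi_A(t,s)\|\le K\left(\frac{\mu(t)}{\mu(s)}\right)^{\mathrm{sgn}(t-s)a}\mu(s)^{\mathrm{sgn}(s)\epsilon}$ for all $t,s\in\mathbb R$. * $A$ admits a nonuniform $\mu$-dichotomy if there are projections $P(t)\in\mathbb R^{d\times d}$, $t\in\mathbb R$, with $P(t)\Phi_A(t,s)=\Phi_A(t,s)P(s)$ for all $t,s$, and constants $K\ge1$, $\alpha<0<\beta$, $\theta,\nu\ge0$ with $\alpha+\theta<0$, $\beta-\nu>0$, such that $\|\Phi_A(t,s)P(s)\|\le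 K\left(\frac{\mu(t)}{\mu(s)}\right)^{\alpha}\mu(s)^{\mathrm{sgn}(s)\theta}$ for $t\ge s$ and $\|\Phi_A(t,s)(\mathrm{Id}-P(s))\|\le K\left(\frac{\mu(t)}{\mu(s)}\right)^{\beta}\mu(s)^{\mathrm{sgn}(s)\nu}$ for $t\le s$. * The nonuniform $\mu$-dichotomy spectrum $\Sigma(A)$ is the set of $\gamma\in\mathbb R$ for which the shifted system $y'=\left[A(t)-\gamma\frac{\mu'(t)}{\mu(t)}\mathrm{Id}\right]y$ does not admit a nonuniform $\mu$-dichotomy. * For $\varepsilon\ge 0$, the systems $y'=A(t)y$ and $z'=B(t)z$ are nonuniformly $(\mu,\varepsilon)$-kinematically similar if there are $M>0$ and a differentiable $S:\mathbb R\to GL_d(\mathbb R)$ such that $\|S(t)\|\le M\mu(t)^{\mathrm{sgn}(t)\varepsilon}$ and $\|S(t)^{-1}\|\le M\mu(t)^{\mathrm{sgn}(t)\varepsilon}$ for all $t$, $S^{-1}y$ solves the $B$-system whenever $y$ solves the $A$-system, and $Sz$ solves the $A$-system whenever $z$ solves the $B$-system. * A set $\Sigma\subset\mathbb R$ is nonresonant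 up to order $p\in\mathbb N$ if $\Sigma=[a_1,b_1]\cup\dots\cup[a_n,b_n]$ for some $n\ge1$ and reals $a_i\le b_i$ with $b_i<a_{i+1}$, and for every $j\in\{1,\dots,n\}$ and all integers $k_1,\dots,k_n\ge0$ with $2\le\sum_i k_i\le p$, $$[a_j,b_j]\cap\Big[\sum_{i=1}^n k_ia_i,\ \sum_{i=1}^n k_ib_i\Big]=\emptyset .$$ Corollary. Suppose that $A$ has $(\mathrm N\mu,\epsilon)$-growth for some $\epsilon\ge 0$ and that $\Sigma(A)$ is nonresonant up to order $p$. Then there is $\varepsilon>0$ such that for every system $z'=B(t)z$ that is nonuniformly $(\mu,\varepsilon)$-kinematically similar to $y'=A(t)y$, the spectrum $\Sigma(B)$ is also nonresonant up to order $p$. -/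

import Mathlib

open MeasureTheory Filter Topology
open scoped Matrix Matrix.Norms.L2Operator

/-- Real `d × d` matrices. The norm in force is the operator norm induced by the Euclidean norm
on `ℝ^d`. All norms on this finite-dimensional space are equivalent, and every estimate below holds
up to an existentially quantified multiplicative constant, so none of the notions depends on
the choice of the norm. -/
abbrev RMat (d : ℕ) : Type := Matrix (Fin d) (Fin d) ℝ

/-- A growth rate: a strictly increasing function `μ : ℝ → (0, ∞)` with `μ 0 = 1`, tending
to `∞` at `∞` and to `0` at `-∞`. -/
structure IsGrowthRate (μ : ℝ → ℝ) : Prop where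
  pos : ∀ t, 0 < μ t
  strictMono : StrictMono μ
  map_zero : μ 0 = 1
  tendsto_atTop : Tendsto μ atTop atTop
  tendsto_atBot : Tendsto μ atBot (𝓝 0)

/-- A differentiable growth rate. -/
structure IsDifferentiableGrowthRate (μ : ℝ → ℝ) : Prop extends IsGrowthRate μ where
  differentiable : Differentiable ℝ μ

/-- `y` is a (Carathéodory) solution on `ℝ` of the linear system `y' = A(t) y`, in integral form:
`A y` is integrable on every compact interval and `y(t) = y(s) + ∫_s^t A(τ) y(τ) dτ`.
Equivalently, `y` is locally absolutely continuous and satisfies the equation almost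
everywhere. -/
def IsLinearSolution {d : ℕ} (A : ℝ → RMat d) (y : ℝ → Fin d → ℝ) : Prop :=
  ∀ s t : ℝ, IntervalIntegrable (fun τ => A τ *ᵥ y τ) volume s t ∧
    y t = y s + ∫ τ in s..t, A τ *ᵥ y τ

/-- `Φ` is the evolution operator (transition matrix) of `y' = A(t) y`: for all `s` and `x₀` the
function `t ↦ Φ(t,s) x₀` is the solution with value `x₀` at time `s`. For locally
integrable `A` there is exactly one such `Φ`. -/
def IsEvolutionOperator {d : ℕ} (A : ℝ → RMat d) (Φ : ℝ → ℝ → RMat d) : Prop :=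
  ∀ (s : ℝ) (x₀ : Fin d → ℝ),
    IsLinearSolution A (fun t => Φ t s *ᵥ x₀) ∧ Φ s s *ᵥ x₀ = x₀

/-- The system `y' = A(t) y` has nonuniform `μ`-bounded growth with parameter `ϵ`. -/
def HasNonuniformGrowth {d : ℕ} (μ : ℝ → ℝ) (ϵ : ℝ) (A : ℝ → RMat d) : Prop :=
  ∃ Φ : ℝ → ℝ → RMat d, IsEvolutionOperator A Φ ∧
    ∃ K a : ℝ, 1 ≤ K ∧ 0 ≤ a ∧
      ∀ t s : ℝ, ‖Φ t s‖ ≤ K * (μ t / μ s) ^ (Real.sign (t - s) * a) * μ s ^ (Real.sign s * ϵ)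

/-- The system `y' = A(t) y` admits a nonuniform `μ`-dichotomy. -/
def HasNonuniformDichotomy {d : ℕ} (μ : ℝ → ℝ) (A : ℝ → RMat d) : Prop :=
  ∃ Φ : ℝ → ℝ → RMat d, IsEvolutionOperator A Φ ∧
    ∃ P : ℝ → RMat d,
      (∀ t, P t * P t = P t) ∧
      (∀ t s, P t * Φ t s = Φ t s * P s) ∧
      ∃ K α β θ ν : ℝ, 1 ≤ K ∧ α < 0 ∧ 0 < β ∧ 0 ≤ θ ∧ 0 ≤ ν ∧ α + θ < 0 ∧ 0 < β - ν ∧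
        (∀ t s, s ≤ t →
          ‖Φ t s * P s‖ ≤ K * (μ t / μ s) ^ α * μ s ^ (Real.sign s * θ)) ∧
        (∀ t s, t ≤ s →
          ‖Φ t s * (1 - P s)‖ ≤ K * (μ t / μ s) ^ β * μ s ^ (Real.sign s * ν))

/-- The coefficient `A(t) - γ (μ'(t) / μ(t)) Id` of the `γ`-shifted system. -/
noncomputable def shiftedCoeff {d : ℕ} (μ : ℝ → ℝ) (A : ℝ → RMat d) (γ : ℝ) : ℝ → RMat d :=
  fun t => A t - (γ * (deriv μ t / μ t)) • (1 : RMat d)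

/-- The nonuniform `μ`-dichotomy spectrum of `y' = A(t) y`. -/
def dichotomySpectrum {d : ℕ} (μ : ℝ → ℝ) (A : ℝ → RMat d) : Set ℝ :=
  {γ : ℝ | ¬ HasNonuniformDichotomy μ (shiftedCoeff μ A γ)}

/-- The systems `y' = A(t) y` and `z' = B(t) z` are nonuniformly `(μ, ε)`-kinematically
similar, through a change of variables `y = S(t) z`. -/
def KinematicallySimilar {d : ℕ} (μ : ℝ → ℝ) (ε : ℝ) (A B : ℝ → RMat d) : Prop :=
  ∃ (M : ℝ) (S : ℝ → Matrix.GeneralLinearGroup (Fin d) ℝ),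
    0 < M ∧
    Differentiable ℝ (fun t => (S t : RMat d)) ∧
    (∀ t, ‖(S t : RMat d)‖ ≤ M * μ t ^ (Real.sign t * ε)) ∧
    (∀ t, ‖(((S t)⁻¹ : Matrix.GeneralLinearGroup (Fin d) ℝ) : RMat d)‖
      ≤ M * μ t ^ (Real.sign t * ε)) ∧
    (∀ y : ℝ → Fin d → ℝ, IsLinearSolution A y →
      IsLinearSolution B
        (fun t => (((S t)⁻¹ : Matrix.GeneralLinearGroup (Fin d) ℝ) : RMat d) *ᵥ y t)) ∧
    (∀ z : ℝ → Fin d → ℝ, IsLinearSolution B z →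
      IsLinearSolution A (fun t => (S t : RMat d) *ᵥ z t))

/-- A set `X` of reals is nonresonant up to order `p`: it is a disjoint union of finitely many (at
least one) compact intervals `[a_1, b_1], …, [a_n, b_n]`, listed increasingly, and no `[a_j, b_j]`
meets `[∑ k_i a_i, ∑ k_i b_i]` when `k ∈ ℕ^n` satisfies `2 ≤ ∑ k_i ≤ p`. The intervals are
the connected components of `X`, so they are determined by `X`. -/
def IsNonresonantUpTo (p : ℕ) (X : Set ℝ) : Prop :=
  ∃ (n : ℕ) (a b : Fin n → ℝ),
    0 < n ∧
    (∀ i, a i ≤ b i) ∧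
    (∀ i j, i < j → b i < a j) ∧
    X = ⋃ i, Set.Icc (a i) (b i) ∧
    ∀ (j : Fin n) (k : Fin n → ℕ), 2 ≤ ∑ i, k i → ∑ i, k i ≤ p →
      Set.Icc (a j) (b j) ∩ Set.Icc (∑ i, (k i : ℝ) * a i) (∑ i, (k i : ℝ) * b i) = ∅

/-! Undoing the shift turns a dichotomy of the `γ`-shifted system into two bounds on `Φ` itself,
with exponents `a`, `b` and nonuniformities `θ`, `ν` such that `a + θ < γ < b - ν`. Hence the
resolvent set is a union of open intervals `(l, r)`, each carried by an invariant family of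
projections (`IsSplitting`). A kinematic similarity contributes a weight at time `t` and one at time
`s`. Trading the first for a power of `μ t / μ s` and a second weight at `s` moves each exponent by
`ε` and each nonuniformity by `2 * ε`, so the interval loses only `3 * ε` on each side
(`IsSplitting.conj`). Bounded growth confines the spectrum to a compact interval, and compactness
gives a uniform margin outside its `δ`-neighbourhood
(`IsDifferentiableGrowthRate.exists_splitting_margin`). For small `ε` the spectrum of `B` therefore
lies in that neighbourhood.

It must also be a nonempty finite union of compact intervals. The projections of two splittings are
nested according to the order of their intervals (`IsSplitting.mul_eq`). Their rank is thus monotone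
on the resolvent set, and equal ranks at two points force equal projections and leave no spectrum in
between. As the rank rises from `0` to `d`, the spectrum is nonempty and has finitely many
components.

Nonresonance consists of finitely many strict inequalities, so it survives a small enlargement of
the intervals. Several components of the new spectrum may lie in one enlarged interval; adding their
multiplicities preserves the order of a resonance (`IsNonresonantUpTo.exists_thickening`). -/

/-! ### Carathéodory solutions of linear systems -/

/-- The matrix-vector product is bounded by the operator norm, up to a constant. -/
theorem exists_norm_mulVec_le (d : ℕ) :
    ∃ C : ℝ, 0 < C ∧ ∀ (A : RMat d) (v : Fin d → ℝ), ‖A *ᵥ v‖ ≤ C * ‖A‖ * ‖v‖ := by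
  set e := ((EuclideanSpace.equiv (Fin d) ℝ).symm : (Fin d → ℝ) →L[ℝ] EuclideanSpace ℝ (Fin d))
  refine ⟨‖e‖ + 1, by positivity, fun A v => ?_⟩
  have h1 : ‖A *ᵥ v‖ ≤ ‖e (A *ᵥ v)‖ := by
    refine (pi_norm_le_iff_of_nonneg (norm_nonneg _)).2 fun i => ?_
    exact PiLp.norm_apply_le (e (A *ᵥ v)) i
  have h2 : ‖e (A *ᵥ v)‖ ≤ ‖A‖ * ‖e v‖ := Matrix.l2_opNorm_mulVec A (e v)
  calc ‖A *ᵥ v‖ ≤ ‖A‖ * ‖e v‖ := h1.trans h2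
    _ ≤ ‖A‖ * ((‖e‖ + 1) * ‖v‖) := by
        gcongr
        exact (e.le_opNorm v).trans (by gcongr; linarith)
    _ = (‖e‖ + 1) * ‖A‖ * ‖v‖ := by ring

theorem intervalIntegrable_pi_iff {d : ℕ} {f : ℝ → Fin d → ℝ} {s t : ℝ} :
    IntervalIntegrable f volume s t ↔
      ∀ i, IntervalIntegrable (fun τ => f τ i) volume s t := by
  simp only [intervalIntegrable_iff, IntegrableOn]
  exact ⟨fun h i => h.eval i, fun h => Integrable.of_eval h⟩

theorem intervalIntegral_apply {d : ℕ} {f : ℝ → Fin d → ℝ} {s t : ℝ}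
    (hf : IntervalIntegrable f volume s t) (i : Fin d) :
    (∫ τ in s..t, f τ) i = ∫ τ in s..t, f τ i :=
  ((ContinuousLinearMap.proj (R := ℝ) (φ := fun _ : Fin d => ℝ) i).intervalIntegral_comp_comm
    hf).symm

/-- Componentwise form of the notion of a solution. -/
theorem isLinearSolution_iff {d : ℕ} {A : ℝ → RMat d} {y : ℝ → Fin d → ℝ} :
    IsLinearSolution A y ↔ ∀ i s t,
      IntervalIntegrable (fun τ => (A τ *ᵥ y τ) i) volume s t ∧
        y t i = y s i + ∫ τ in s..t, (A τ *ᵥ y τ) i := by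
  constructor
  · intro h i s t
    obtain ⟨h1, h2⟩ := h s t
    refine ⟨intervalIntegrable_pi_iff.1 h1 i, ?_⟩
    rw [← intervalIntegral_apply h1]
    exact congrFun h2 i
  · intro h s t
    have h1 := intervalIntegrable_pi_iff.2 fun i => (h i s t).1
    refine ⟨h1, funext fun i => ?_⟩
    rw [Pi.add_apply, intervalIntegral_apply h1]
    exact (h i s t).2

theorem IsLinearSolution.continuous {d : ℕ} {A : ℝ → RMat d} {y : ℝ → Fin d → ℝ}
    (h : IsLinearSolution A y) : Continuous y := by
  have : y = fun t => y 0 + ∫ τ in (0 : ℝ)..t, A τ *ᵥ y τ := funext fun t => (h 0 t).2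
  rw [this]
  exact continuous_const.add
    (intervalIntegral.continuous_primitive (fun s t => (h s t).1) 0)

theorem IsLinearSolution.sub {d : ℕ} {A : ℝ → RMat d} {y z : ℝ → Fin d → ℝ}
    (hy : IsLinearSolution A y) (hz : IsLinearSolution A z) :
    IsLinearSolution A (fun t => y t - z t) := by
  intro s t
  simp only [Matrix.mulVec_sub]
  refine ⟨(hy s t).1.sub (hz s t).1, ?_⟩
  rw [intervalIntegral.integral_sub (hy s t).1 (hz s t).1, (hy s t).2, (hz s t).2]
  abel

/-- A solution with a zero vanishes near that zero. -/
theorem IsLinearSolution.eventually_eq_zero {d : ℕ} {A : ℝ → RMat d}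
    (hA : LocallyIntegrable A volume) {y : ℝ → Fin d → ℝ} (hy : IsLinearSolution A y)
    {t₀ : ℝ} (h0 : y t₀ = 0) : ∀ᶠ t in 𝓝 t₀, y t = 0 := by
  obtain ⟨C, hC, hAv⟩ := exists_norm_mulVec_le d
  have hint : ∀ s t, IntervalIntegrable (fun τ => ‖A τ‖) volume s t := fun s t =>
    ((hA.integrableOn_isCompact isCompact_uIcc).mono_set Set.uIoc_subset_uIcc |>
      intervalIntegrable_iff.2).norm
  have hcont : Continuous fun t => ∫ τ in t₀..t, ‖A τ‖ :=
    intervalIntegral.continuous_primitive hint t₀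
  -- The threshold makes `C * ∫ ‖A‖` at most `1 / 2` near `t₀`, so the integral equation bounds the
  -- maximum of `‖y‖` on a small ball by half of itself.
  have hlim : ∀ᶠ t in 𝓝 t₀, |∫ τ in t₀..t, ‖A τ‖| < 1 / (2 * C) := by
    have : Tendsto (fun t => |∫ τ in t₀..t, ‖A τ‖|) (𝓝 t₀) (𝓝 |∫ τ in t₀..t₀, ‖A τ‖|) :=
      (hcont.abs).tendsto t₀
    rw [intervalIntegral.integral_same, abs_zero] at this
    exact this.eventually (gt_mem_nhds (by positivity))
  obtain ⟨η, hη, hball⟩ := Metric.nhds_basis_closedBall.eventually_iff.1 hlim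
  obtain ⟨t₁, ht₁, hmax⟩ := (isCompact_closedBall t₀ η).exists_isMaxOn
    ⟨t₀, Metric.mem_closedBall_self hη.le⟩ hy.continuous.norm.continuousOn
  have hzero : ‖y t₁‖ ≤ ‖y t₁‖ / 2 := by
    have hsub : Set.uIoc t₀ t₁ ⊆ Metric.closedBall t₀ η :=
      Set.uIoc_subset_uIcc.trans <| (convex_closedBall t₀ η).ordConnected.uIcc_subset
        (Metric.mem_closedBall_self hη.le) ht₁
    calc ‖y t₁‖ = ‖∫ τ in t₀..t₁, A τ *ᵥ y τ‖ := by rw [(hy t₀ t₁).2, h0, zero_add]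
      _ ≤ |∫ τ in t₀..t₁, C * ‖A τ‖ * ‖y t₁‖| := by
          refine intervalIntegral.norm_integral_le_abs_of_norm_le ?_
            (((hint t₀ t₁).const_mul C).mul_const _)
          refine (ae_restrict_iff' measurableSet_uIoc).2 (Eventually.of_forall fun τ hτ => ?_)
          exact (hAv _ _).trans (by gcongr; exact hmax (hsub hτ))
      _ = C * |∫ τ in t₀..t₁, ‖A τ‖| * ‖y t₁‖ := by
          rw [intervalIntegral.integral_mul_const, intervalIntegral.integral_const_mul, abs_mul,
            abs_mul, abs_of_pos hC, abs_norm]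
      _ ≤ C * (1 / (2 * C)) * ‖y t₁‖ := by gcongr; exact (hball ht₁).le
      _ = ‖y t₁‖ / 2 := by field_simp
  have ht₁0 : ‖y t₁‖ = 0 := le_antisymm (by linarith) (norm_nonneg _)
  filter_upwards [Metric.closedBall_mem_nhds t₀ hη] with t ht
  exact norm_le_zero_iff.1 (ht₁0 ▸ hmax ht)

/-- Uniqueness of Carathéodory solutions. -/
theorem IsLinearSolution.ext {d : ℕ} {A : ℝ → RMat d}
    (hA : LocallyIntegrable A volume) {y z : ℝ → Fin d → ℝ} (hy : IsLinearSolution A y)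
    (hz : IsLinearSolution A z) {s : ℝ} (h : y s = z s) : y = z := by
  have hclopen : IsClopen {t | y t - z t = 0} :=
    ⟨isClosed_eq (hy.sub hz).continuous continuous_const,
      isOpen_iff_mem_nhds.2 fun t ht => (hy.sub hz).eventually_eq_zero hA ht⟩
  have huniv := hclopen.eq_univ ⟨s, sub_eq_zero.2 h⟩
  exact funext fun t => sub_eq_zero.1 (huniv ▸ Set.mem_univ t : t ∈ {t | y t - z t = 0})

/-- Growth and dichotomy each come with their own existentially quantified evolution operator;
uniqueness identifies them. -/
theorem IsEvolutionOperator.unique {d : ℕ} {A : ℝ → RMat d}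
    (hA : LocallyIntegrable A volume) {Φ Ψ : ℝ → ℝ → RMat d}
    (hΦ : IsEvolutionOperator A Φ) (hΨ : IsEvolutionOperator A Ψ) : Φ = Ψ := by
  funext t s
  refine Matrix.ext_of_mulVec_single fun i => ?_
  have := (hΦ s (Pi.single i 1)).1.ext hA (hΨ s (Pi.single i 1)).1
    (((hΦ s _).2).trans ((hΨ s _).2).symm)
  exact congrFun this t

theorem IsEvolutionOperator.self {d : ℕ} {A : ℝ → RMat d} {Φ : ℝ → ℝ → RMat d}
    (hΦ : IsEvolutionOperator A Φ) (s : ℝ) : Φ s s = 1 :=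
  Matrix.ext_of_mulVec_single fun i => by rw [(hΦ s _).2, Matrix.one_mulVec]

theorem IsEvolutionOperator.mul {d : ℕ} {A : ℝ → RMat d} (hA : LocallyIntegrable A volume)
    {Φ : ℝ → ℝ → RMat d} (hΦ : IsEvolutionOperator A Φ) (t τ s : ℝ) :
    Φ t τ * Φ τ s = Φ t s := by
  refine Matrix.ext_of_mulVec_single fun i => ?_
  rw [← Matrix.mulVec_mulVec]
  exact congrFun ((hΦ τ (Φ τ s *ᵥ Pi.single i 1)).1.ext hA (hΦ s (Pi.single i 1)).1
    (hΦ τ _).2) t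

/-- Conjugation of an evolution operator by a kinematic similarity. -/
theorem IsEvolutionOperator.conj {d : ℕ} {A B : ℝ → RMat d} {Φ : ℝ → ℝ → RMat d}
    (hΦ : IsEvolutionOperator A Φ) (S : ℝ → Matrix.GeneralLinearGroup (Fin d) ℝ)
    (hS : ∀ y : ℝ → Fin d → ℝ, IsLinearSolution A y → IsLinearSolution B
      (fun t => (((S t)⁻¹ : Matrix.GeneralLinearGroup (Fin d) ℝ) : RMat d) *ᵥ y t)) :
    IsEvolutionOperator B (fun t s =>
      (((S t)⁻¹ : Matrix.GeneralLinearGroup (Fin d) ℝ) : RMat d) * Φ t s * (S s : RMat d)) := by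
  intro s x₀
  simp only [← Matrix.mulVec_mulVec]
  refine ⟨hS _ (hΦ s _).1, ?_⟩
  rw [(hΦ s _).2, Matrix.mulVec_mulVec, Units.inv_mul, Matrix.one_mulVec]

/-! ### Shifted systems -/

theorem absolutelyContinuousOnInterval_of_eq_integral {u u' : ℝ → ℝ} {s t : ℝ}
    (hu' : IntervalIntegrable u' volume s t) (hu : ∀ x, u x = u s + ∫ τ in s..x, u' τ) :
    AbsolutelyContinuousOnInterval u s t := by
  have h1 := (LipschitzWith.const (u s)).lipschitzOnWith (s := Set.uIcc s t)
    |>.absolutelyContinuousOnInterval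
  have h2 := hu'.absolutelyContinuousOnInterval_intervalIntegral Set.left_mem_uIcc
  have : u = (fun _ => u s) + fun x => ∫ τ in s..x, u' τ := funext hu
  rw [this]
  exact h1.add h2

theorem ae_deriv_eq_of_eq_integral {u u' : ℝ → ℝ} {s t : ℝ}
    (hu' : IntervalIntegrable u' volume s t) (hu : ∀ x, u x = u s + ∫ τ in s..x, u' τ) :
    ∀ᵐ x, x ∈ Set.uIcc s t → deriv u x = u' x := by
  filter_upwards [hu'.ae_hasDerivAt_integral] with x hx hxs
  have := (hx hxs s Set.left_mem_uIcc).const_add (u s)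
  rw [show u = fun x => u s + ∫ τ in s..x, u' τ from funext hu]
  exact this.deriv

/-- The product rule for indefinite integrals. -/
theorem mul_eq_add_integral {u u' v v' : ℝ → ℝ} {s t : ℝ}
    (hu' : IntervalIntegrable u' volume s t) (hu : ∀ x, u x = u s + ∫ τ in s..x, u' τ)
    (hv' : IntervalIntegrable v' volume s t) (hv : ∀ x, v x = v s + ∫ τ in s..x, v' τ) :
    u t * v t = u s * v s + ∫ τ in s..t, (u' τ * v τ + u τ * v' τ) := by
  have h := (absolutelyContinuousOnInterval_of_eq_integral hu' hu).integral_deriv_mul_eq_sub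
    (absolutelyContinuousOnInterval_of_eq_integral hv' hv)
  have hcongr : ∫ τ in s..t, (deriv u τ * v τ + u τ * deriv v τ) =
      ∫ τ in s..t, (u' τ * v τ + u τ * v' τ) := by
    refine intervalIntegral.integral_congr_ae ?_
    filter_upwards [ae_deriv_eq_of_eq_integral hu' hu, ae_deriv_eq_of_eq_integral hv' hv]
      with x hx1 hx2 hx
    rw [hx1 (Set.uIoc_subset_uIcc hx), hx2 (Set.uIoc_subset_uIcc hx)]
  rw [← hcongr, h]
  ring

namespace IsDifferentiableGrowthRate

variable {μ : ℝ → ℝ}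

theorem hasDerivAt_rpow (hμ : IsDifferentiableGrowthRate μ) (c t : ℝ) :
    HasDerivAt (fun τ => μ τ ^ c) (c * (deriv μ t / μ t) * μ t ^ c) t := by
  have h := (hμ.differentiable t).hasDerivAt.rpow_const (p := c) (Or.inl (hμ.pos t).ne')
  convert h using 1
  rw [Real.rpow_sub_one (hμ.pos t).ne']
  ring

/-- The derivative of `μ` need not be continuous. It is integrable on compact intervals because it
is nonnegative and `μ` is differentiable everywhere; the remaining factor is continuous. -/
theorem intervalIntegrable_deriv_rpow (hμ : IsDifferentiableGrowthRate μ) (c s t : ℝ) :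
    IntervalIntegrable (fun τ => c * (deriv μ τ / μ τ) * μ τ ^ c) volume s t := by
  have h1 : IntervalIntegrable (deriv μ) volume s t :=
    intervalIntegral.intervalIntegrable_deriv_of_nonneg hμ.differentiable.continuous.continuousOn
      (fun x _ => (hμ.differentiable x).hasDerivAt) (fun x _ => hμ.strictMono.monotone.deriv_nonneg)
  have h2 : Continuous fun τ => c / μ τ * μ τ ^ c :=
    (continuous_const.div hμ.differentiable.continuous fun τ => (hμ.pos τ).ne').mul
      (hμ.differentiable.continuous.rpow_const fun τ => Or.inl (hμ.pos τ).ne')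
  refine (h1.mul_continuousOn h2.continuousOn).congr fun τ _ => ?_
  ring

theorem isLinearSolution_smul (hμ : IsDifferentiableGrowthRate μ) {d : ℕ} {A : ℝ → RMat d}
    {y : ℝ → Fin d → ℝ} (hy : IsLinearSolution A y) (γ : ℝ) :
    IsLinearSolution (shiftedCoeff μ A γ) (fun t => μ t ^ (-γ) • y t) := by
  rw [isLinearSolution_iff]
  intro i s t
  have hyi := isLinearSolution_iff.1 hy i
  have hw' := hμ.intervalIntegrable_deriv_rpow (-γ) s t
  have hw : ∀ x, μ x ^ (-γ) =
      μ s ^ (-γ) + ∫ τ in s..x, -γ * (deriv μ τ / μ τ) * μ τ ^ (-γ) := by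
    intro x
    rw [intervalIntegral.integral_eq_sub_of_hasDerivAt (fun τ _ => hμ.hasDerivAt_rpow (-γ) τ)
      (hμ.intervalIntegrable_deriv_rpow (-γ) s x)]
    ring
  have heq : (fun τ => (shiftedCoeff μ A γ τ *ᵥ (μ τ ^ (-γ) • y τ)) i) =
      fun τ => -γ * (deriv μ τ / μ τ) * μ τ ^ (-γ) * y τ i +
        μ τ ^ (-γ) * (A τ *ᵥ y τ) i := by
    funext τ
    simp only [shiftedCoeff, Matrix.sub_mulVec, Matrix.mulVec_smul, Matrix.smul_mulVec,
      Matrix.one_mulVec, Pi.sub_apply, Pi.smul_apply, smul_eq_mul]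
    ring
  have hwc : Continuous fun τ => μ τ ^ (-γ) :=
    hμ.differentiable.continuous.rpow_const fun τ => Or.inl (hμ.pos τ).ne'
  have hyc : Continuous fun τ => y τ i := (continuous_apply i).comp hy.continuous
  rw [heq]
  refine ⟨(hw'.mul_continuousOn hyc.continuousOn).add
    ((hyi s t).1.continuousOn_mul hwc.continuousOn), ?_⟩
  exact mul_eq_add_integral hw' hw (hyi s t).1 fun x => (hyi s x).2

theorem isEvolutionOperator_smul (hμ : IsDifferentiableGrowthRate μ) {d : ℕ} {A : ℝ → RMat d}
    {Φ : ℝ → ℝ → RMat d} (hΦ : IsEvolutionOperator A Φ) (γ : ℝ) :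
    IsEvolutionOperator (shiftedCoeff μ A γ) (fun t s => (μ t / μ s) ^ (-γ) • Φ t s) := by
  intro s x₀
  have h := hμ.isLinearSolution_smul (hΦ s ((μ s ^ (-γ))⁻¹ • x₀)).1 γ
  constructor
  · convert h using 2 with t
    beta_reduce
    rw [Real.div_rpow (hμ.pos t).le (hμ.pos s).le, Matrix.smul_mulVec, Matrix.mulVec_smul,
      smul_smul, div_eq_mul_inv]
  · beta_reduce
    rw [div_self (hμ.pos s).ne', Real.one_rpow, one_smul, (hΦ s x₀).2]

theorem shiftedCoeff_neg {d : ℕ} (A : ℝ → RMat d) (γ : ℝ) :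
    shiftedCoeff μ (shiftedCoeff μ A γ) (-γ) = A := by
  funext t
  simp only [shiftedCoeff, neg_mul, neg_smul]
  abel

theorem isEvolutionOperator_of_shiftedCoeff (hμ : IsDifferentiableGrowthRate μ) {d : ℕ}
    {A : ℝ → RMat d} {γ : ℝ} {Φ : ℝ → ℝ → RMat d}
    (hΦ : IsEvolutionOperator (shiftedCoeff μ A γ) Φ) :
    IsEvolutionOperator A (fun t s => (μ t / μ s) ^ γ • Φ t s) := by
  simpa only [shiftedCoeff_neg, neg_neg] using hμ.isEvolutionOperator_smul hΦ (-γ)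

end IsDifferentiableGrowthRate

/-! ### Splittings -/

/-- The projections `P` split the evolution operator `Φ` so that `γ` is in the resolvent set for
every `γ` in the open interval `(l, r)`. -/
def IsSplitting {d : ℕ} (μ : ℝ → ℝ) (Φ : ℝ → ℝ → RMat d) (P : ℝ → RMat d) (l r : ℝ) : Prop :=
  (∀ t, P t * P t = P t) ∧ (∀ t s, P t * Φ t s = Φ t s * P s) ∧
    ∃ K a b θ ν : ℝ, 1 ≤ K ∧ 0 ≤ θ ∧ 0 ≤ ν ∧ a + θ ≤ l ∧ r ≤ b - ν ∧
      (∀ t s, s ≤ t → ‖Φ t s * P s‖ ≤ K * (μ t / μ s) ^ a * μ s ^ (Real.sign s * θ)) ∧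
      (∀ t s, t ≤ s → ‖Φ t s * (1 - P s)‖ ≤ K * (μ t / μ s) ^ b * μ s ^ (Real.sign s * ν))

section Splitting

variable {d : ℕ} {μ : ℝ → ℝ} {Φ : ℝ → ℝ → RMat d}

/-- The resolvent set is the union of the intervals provided by splittings. -/
theorem IsDifferentiableGrowthRate.hasNonuniformDichotomy_iff (hμ : IsDifferentiableGrowthRate μ)
    {A : ℝ → RMat d} (hA : LocallyIntegrable A volume) (hΦ : IsEvolutionOperator A Φ) (γ : ℝ) :
    HasNonuniformDichotomy μ (shiftedCoeff μ A γ) ↔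
      ∃ P l r, IsSplitting μ Φ P l r ∧ l < γ ∧ γ < r := by
  have hq : ∀ t s, 0 < μ t / μ s := fun t s => div_pos (hμ.pos t) (hμ.pos s)
  constructor
  · rintro ⟨Ψ, hΨ, P, hP, hcomm, K, α, β, θ, ν, hK, -, -, hθ, hν, hαθ, hβν, h1, h2⟩
    -- By uniqueness `Φ` is the unshifted `Ψ`, so every exponent of the dichotomy is translated by
    -- `γ`.
    obtain rfl := hΦ.unique hA (hμ.isEvolutionOperator_of_shiftedCoeff hΨ)
    refine ⟨P, γ + α + θ, γ + β - ν, ⟨hP, fun t s => ?_, K, γ + α, γ + β, θ, ν, hK, hθ, hν, le_rfl,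
      le_rfl, fun t s hst => ?_, fun t s hst => ?_⟩, by linarith, by linarith⟩
    · rw [Matrix.mul_smul, Matrix.smul_mul, hcomm]
    · rw [Matrix.smul_mul, norm_smul, Real.norm_of_nonneg (Real.rpow_nonneg (hq t s).le _),
        Real.rpow_add (hq t s)]
      calc _ ≤ (μ t / μ s) ^ γ * (K * (μ t / μ s) ^ α * μ s ^ (Real.sign s * θ)) := by
            gcongr
            · exact Real.rpow_nonneg (hq t s).le _
            · exact h1 t s hst
        _ = _ := by ring
    · rw [Matrix.smul_mul, norm_smul, Real.norm_of_nonneg (Real.rpow_nonneg (hq t s).le _),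
        Real.rpow_add (hq t s)]
      calc _ ≤ (μ t / μ s) ^ γ * (K * (μ t / μ s) ^ β * μ s ^ (Real.sign s * ν)) := by
            gcongr
            · exact Real.rpow_nonneg (hq t s).le _
            · exact h2 t s hst
        _ = _ := by ring
  · rintro ⟨P, l, r, ⟨hP, hcomm, K, a, b, θ, ν, hK, hθ, hν, hl, hr, h1, h2⟩, hlγ, hγr⟩
    refine ⟨_, hμ.isEvolutionOperator_smul hΦ γ, P, hP, fun t s => ?_, K, a - γ, b - γ, θ, ν, hK,
      by linarith, by linarith, hθ, hν, by linarith, by linarith, fun t s hst => ?_,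
      fun t s hst => ?_⟩
    · rw [Matrix.mul_smul, Matrix.smul_mul, hcomm]
    · rw [Matrix.smul_mul, norm_smul, Real.norm_of_nonneg (Real.rpow_nonneg (hq t s).le _),
        sub_eq_add_neg a γ, Real.rpow_add (hq t s)]
      calc _ ≤ (μ t / μ s) ^ (-γ) * (K * (μ t / μ s) ^ a * μ s ^ (Real.sign s * θ)) := by
            gcongr
            · exact Real.rpow_nonneg (hq t s).le _
            · exact h1 t s hst
        _ = _ := by ring
    · rw [Matrix.smul_mul, norm_smul, Real.norm_of_nonneg (Real.rpow_nonneg (hq t s).le _),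
        sub_eq_add_neg b γ, Real.rpow_add (hq t s)]
      calc _ ≤ (μ t / μ s) ^ (-γ) * (K * (μ t / μ s) ^ b * μ s ^ (Real.sign s * ν)) := by
            gcongr
            · exact Real.rpow_nonneg (hq t s).le _
            · exact h2 t s hst
        _ = _ := by ring

/-! ### Splittings under kinematic similarity -/

/-- The sign of `t` is that of `log (μ t)` because `μ 0 = 1`. In this form the triangle inequality
compares weights at different times. -/
theorem IsGrowthRate.rpow_sign_mul (hμ : IsGrowthRate μ) (t c : ℝ) :
    μ t ^ (Real.sign t * c) = Real.exp (|Real.log (μ t)| * c) := by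
  rw [Real.rpow_def_of_pos (hμ.pos t)]
  congr 1
  rcases lt_trichotomy t 0 with h | h | h
  · have : Real.log (μ t) < 0 :=
      Real.log_neg (hμ.pos t) (hμ.map_zero ▸ hμ.strictMono h)
    rw [Real.sign_of_neg h, abs_of_neg this]
    ring
  · simp [h, hμ.map_zero]
  · have : 0 < Real.log (μ t) := Real.log_pos (hμ.map_zero ▸ hμ.strictMono h)
    rw [Real.sign_of_pos h, abs_of_pos this]
    ring

/-- The effect of a change of variables on one of the bounds of a splitting. -/
theorem IsGrowthRate.norm_conj_le (hμ : IsGrowthRate μ) {ε M K c η : ℝ} (hε : 0 ≤ ε)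
    (hK : 0 ≤ K) {t s : ℝ} {T X U : RMat d}
    (hT : ‖T‖ ≤ M * μ t ^ (Real.sign t * ε)) (hU : ‖U‖ ≤ M * μ s ^ (Real.sign s * ε))
    (hX : ‖X‖ ≤ K * (μ t / μ s) ^ c * μ s ^ (Real.sign s * η)) :
    ‖T * X * U‖ ≤ (K * M ^ 2 + 1) *
      ((μ t / μ s) ^ c * Real.exp (|Real.log (μ t / μ s)| * ε)) *
        μ s ^ (Real.sign s * (η + 2 * ε)) := by
  simp only [hμ.rpow_sign_mul] at *
  set q := (μ t / μ s) ^ c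
  have hq : 0 ≤ q := Real.rpow_nonneg (div_pos (hμ.pos t) (hμ.pos s)).le _
  -- The weight at `t` is replaced by one at `s`, at the cost of a factor depending on `μ t / μ s`
  -- only.
  have hexp : Real.exp (|Real.log (μ t)| * ε) ≤
      Real.exp (|Real.log (μ t / μ s)| * ε) * Real.exp (|Real.log (μ s)| * ε) := by
    rw [← Real.exp_add, ← add_mul, Real.log_div (hμ.pos t).ne' (hμ.pos s).ne']
    gcongr
    linarith [abs_sub_abs_le_abs_sub (Real.log (μ t)) (Real.log (μ s))]
  calc ‖T * X * U‖ ≤ ‖T‖ * ‖X‖ * ‖U‖ :=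
        (norm_mul_le _ _).trans (by gcongr; exact norm_mul_le _ _)
    _ ≤ (M * Real.exp (|Real.log (μ t)| * ε)) *
          (K * q * Real.exp (|Real.log (μ s)| * η)) *
          (M * Real.exp (|Real.log (μ s)| * ε)) := by
        have := (norm_nonneg _).trans hT
        gcongr
    _ = K * M ^ 2 * (q * Real.exp (|Real.log (μ t)| * ε)) *
          (Real.exp (|Real.log (μ s)| * η) * Real.exp (|Real.log (μ s)| * ε)) := by ring
    _ ≤ (K * M ^ 2 + 1) * (q *
          (Real.exp (|Real.log (μ t / μ s)| * ε) * Real.exp (|Real.log (μ s)| * ε))) *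
          (Real.exp (|Real.log (μ s)| * η) * Real.exp (|Real.log (μ s)| * ε)) := by
        gcongr
        linarith
    _ = (K * M ^ 2 + 1) * (q * Real.exp (|Real.log (μ t / μ s)| * ε)) *
          (Real.exp (|Real.log (μ s)| * η) * Real.exp (|Real.log (μ s)| * ε) *
            Real.exp (|Real.log (μ s)| * ε)) := by ring
    _ = _ := by
        rw [← Real.exp_add, ← Real.exp_add]
        congr 2
        ring

/-- A kinematic similarity shrinks the interval of a splitting by at most `3 ε` on each side. -/
theorem IsSplitting.conj (hμ : IsGrowthRate μ) {P : ℝ → RMat d} {l r : ℝ}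
    (h : IsSplitting μ Φ P l r) {ε M : ℝ} (hε : 0 ≤ ε)
    (S : ℝ → Matrix.GeneralLinearGroup (Fin d) ℝ)
    (hS : ∀ t, ‖(S t : RMat d)‖ ≤ M * μ t ^ (Real.sign t * ε))
    (hS' : ∀ t, ‖(((S t)⁻¹ : Matrix.GeneralLinearGroup (Fin d) ℝ) : RMat d)‖
      ≤ M * μ t ^ (Real.sign t * ε)) :
    IsSplitting μ (fun t s =>
        (((S t)⁻¹ : Matrix.GeneralLinearGroup (Fin d) ℝ) : RMat d) * Φ t s * (S s : RMat d))
      (fun t => (((S t)⁻¹ : Matrix.GeneralLinearGroup (Fin d) ℝ) : RMat d) * P t * (S t : RMat d))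
      (l + 3 * ε) (r - 3 * ε) := by
  obtain ⟨hP, hcomm, K, a, b, θ, ν, hK, hθ, hν, hl, hr, h1, h2⟩ := h
  have hcancel : ∀ (X Y : RMat d) (U V : Matrix.GeneralLinearGroup (Fin d) ℝ) (s : ℝ),
      ((U : RMat d) * X * (S s : RMat d)) *
        ((((S s)⁻¹ : Matrix.GeneralLinearGroup (Fin d) ℝ) : RMat d) * Y * (V : RMat d)) =
      (U : RMat d) * (X * Y) * (V : RMat d) := by
    intro X Y U V s
    simp only [mul_assoc, Units.mul_inv_cancel_left]
  have hone : ∀ s, (1 : RMat d) - (((S s)⁻¹ : Matrix.GeneralLinearGroup (Fin d) ℝ) : RMat d) *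
      P s * (S s : RMat d) = (((S s)⁻¹ : Matrix.GeneralLinearGroup (Fin d) ℝ) : RMat d) *
      (1 - P s) * (S s : RMat d) := by
    intro s
    rw [mul_sub, sub_mul, mul_one, Units.inv_mul]
  have hqpos : ∀ t s, 0 < μ t / μ s := fun t s => div_pos (hμ.pos t) (hμ.pos s)
  -- Adding `1` keeps the constant at least `1`. The shift `3 * ε` is `ε` from the exponent plus `2
  -- * ε` from the nonuniformity.
  refine ⟨fun t => ?_, fun t s => ?_, K * M ^ 2 + 1, a + ε, b - ε, θ + 2 * ε, ν + 2 * ε,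
    by nlinarith [sq_nonneg M], by linarith, by linarith, by linarith, by linarith,
    fun t s hst => ?_, fun t s hst => ?_⟩
  · rw [hcancel, hP]
  · rw [hcancel, hcancel, hcomm]
  · rw [hcancel]
    refine (hμ.norm_conj_le hε (by linarith) (hS' t) (hS s) (h1 t s hst)).trans_eq ?_
    have : 0 ≤ Real.log (μ t / μ s) :=
      Real.log_nonneg ((one_le_div (hμ.pos s)).2 (hμ.strictMono.monotone hst))
    rw [abs_of_nonneg this, ← Real.rpow_def_of_pos (hqpos t s), ← Real.rpow_add (hqpos t s)]
  · rw [hone, hcancel]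
    refine (hμ.norm_conj_le hε (by linarith) (hS' t) (hS s) (h2 t s hst)).trans_eq ?_
    have : Real.log (μ t / μ s) ≤ 0 :=
      Real.log_nonpos (hqpos t s).le ((div_le_one (hμ.pos s)).2 (hμ.strictMono.monotone hst))
    rw [abs_of_nonpos this, neg_mul, ← mul_neg, ← Real.rpow_def_of_pos (hqpos t s),
      ← Real.rpow_add (hqpos t s), sub_eq_add_neg]

/-- The two bounds of a splitting are independent: the first determines `l`, the second determines
`r`. -/
theorem IsSplitting.glue (hμ : IsGrowthRate μ) {P : ℝ → RMat d} {l r l' r' : ℝ}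
    (h : IsSplitting μ Φ P l r) (h' : IsSplitting μ Φ P l' r') : IsSplitting μ Φ P l r' := by
  obtain ⟨hP, hcomm, K, a, b, θ, ν, hK, hθ, hν, hl, hr, h1, h2⟩ := h
  obtain ⟨-, -, K', a', b', θ', ν', hK', hθ', hν', hl', hr', h1', h2'⟩ := h'
  have hq : ∀ (t s c : ℝ), 0 ≤ (μ t / μ s) ^ c := fun t s c =>
    Real.rpow_nonneg (div_pos (hμ.pos t) (hμ.pos s)).le _
  have hp : ∀ (s c : ℝ), 0 ≤ μ s ^ c := fun s c => Real.rpow_nonneg (hμ.pos s).le _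
  refine ⟨hP, hcomm, max K K', a, b', θ, ν', hK.trans (le_max_left _ _), hθ, hν', hl, hr',
    fun t s hst => (h1 t s hst).trans ?_, fun t s hst => (h2' t s hst).trans ?_⟩
  · exact mul_le_mul_of_nonneg_right
      (mul_le_mul_of_nonneg_right (le_max_left _ _) (hq _ _ _)) (hp _ _)
  · exact mul_le_mul_of_nonneg_right
      (mul_le_mul_of_nonneg_right (le_max_right _ _) (hq _ _ _)) (hp _ _)

/-! ### Ordering of the projections -/

theorem norm_eq_zero_of_le_rpow {f : ℝ → ℝ} {F : Filter ℝ} [F.NeBot] {X : RMat d} {C c : ℝ}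
    (hlim : Tendsto (fun t => f t ^ c) F (𝓝 0)) (h : ∀ᶠ t in F, ‖X‖ ≤ C * f t ^ c) : X = 0 := by
  have := hlim.const_mul C
  rw [mul_zero] at this
  exact norm_le_zero_iff.1 (ge_of_tendsto this h)

/-- The projections of splittings are ordered in the same way as their intervals. -/
theorem IsSplitting.mul_eq (hμ : IsGrowthRate μ) (hone : ∀ t s, Φ t s * Φ s t = 1)
    {P Q : ℝ → RMat d} {l r l' r' : ℝ} (h : IsSplitting μ Φ P l r)
    (h' : IsSplitting μ Φ Q l' r') (hlr : l < r') : Q 0 * P 0 = P 0 ∧ P 0 * Q 0 = P 0 := by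
  obtain ⟨hP, hcomm, K, a, b, θ, ν, hK, hθ, hν, hl, hr, h1, h2⟩ := h
  obtain ⟨hQ, hcomm', K', a', b', θ', ν', hK', hθ', hν', hl', hr', h1', h2'⟩ := h'
  have hcommP : ∀ t, P 0 = Φ 0 t * P t * Φ t 0 := fun t => by
    rw [← hcomm, mul_assoc, hone, mul_one]
  have hcommQ : ∀ t, 1 - Q 0 = Φ 0 t * (1 - Q t) * Φ t 0 := fun t => by
    rw [mul_sub, mul_one, ← hcomm', sub_mul, mul_assoc, hone, mul_one]
  have hp : ∀ (s c : ℝ), 0 ≤ μ s ^ c := fun s c => Real.rpow_nonneg (hμ.pos s).le _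
  have hinv : ∀ (t c : ℝ), (μ 0 / μ t) ^ c = μ t ^ (-c) := fun t c => by
    rw [hμ.map_zero, one_div, Real.inv_rpow (hμ.pos t).le, Real.rpow_neg (hμ.pos t).le]
  have hdiv : ∀ t, μ t / μ 0 = μ t := fun t => by rw [hμ.map_zero, div_one]
  constructor
  -- Transport to time `t → ∞` and back: the product is bounded by a power of `μ t` with negative
  -- exponent, since `a ≤ l < r' ≤ b' - ν'`.
  · have hz : (1 - Q 0) * P 0 = 0 := by
      refine norm_eq_zero_of_le_rpow (F := atTop) (f := μ) (C := K' * K) (c := -(b' - ν' - a))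
        ((tendsto_rpow_neg_atTop (by linarith)).comp hμ.tendsto_atTop) ?_
      filter_upwards [eventually_gt_atTop 0] with t ht
      have e1 := h2' 0 t ht.le
      have e2 := h1 t 0 ht.le
      rw [hinv, Real.sign_of_pos ht, one_mul] at e1
      rw [hdiv, Real.sign_zero, zero_mul, Real.rpow_zero, mul_one] at e2
      calc ‖(1 - Q 0) * P 0‖ = ‖Φ 0 t * (1 - Q t) * (Φ t 0 * P 0)‖ := by
            rw [hcommQ t, mul_assoc (Φ 0 t * (1 - Q t))]
        _ ≤ ‖Φ 0 t * (1 - Q t)‖ * ‖Φ t 0 * P 0‖ := norm_mul_le _ _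
        _ ≤ (K' * μ t ^ (-b') * μ t ^ ν') * (K * μ t ^ a) := by
            gcongr
            exact (norm_nonneg _).trans e1
        _ = K' * K * (μ t ^ (-b') * μ t ^ ν' * μ t ^ a) := by ring
        _ = K' * K * μ t ^ (-(b' - ν' - a)) := by
            rw [← Real.rpow_add (hμ.pos t), ← Real.rpow_add (hμ.pos t)]
            ring_nf
    rw [sub_mul, one_mul, sub_eq_zero] at hz
    exact hz.symm
  -- Here `t → -∞`, where the weight is `μ t ^ (-θ)`. The total exponent is positive because `a + θ
  -- ≤ l < r' ≤ b'`.
  · have hz : P 0 * (1 - Q 0) = 0 := by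
      have hlim : Tendsto (fun t => μ t ^ (b' - a - θ)) atBot (𝓝 0) := by
        have hc : 0 < b' - a - θ := by linarith
        have := hμ.tendsto_atBot.rpow_const (p := b' - a - θ) (Or.inr hc.le)
        rwa [Real.zero_rpow hc.ne'] at this
      refine norm_eq_zero_of_le_rpow (F := atBot) (f := μ) (C := K * K') hlim ?_
      filter_upwards [eventually_lt_atBot 0] with t ht
      have e1 := h1 0 t ht.le
      have e2 := h2' t 0 ht.le
      rw [hinv, Real.sign_of_neg ht, neg_one_mul] at e1
      rw [hdiv, Real.sign_zero, zero_mul, Real.rpow_zero, mul_one] at e2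
      calc ‖P 0 * (1 - Q 0)‖ = ‖Φ 0 t * P t * (Φ t 0 * (1 - Q 0))‖ := by
            rw [hcommP t, mul_assoc (Φ 0 t * P t)]
        _ ≤ ‖Φ 0 t * P t‖ * ‖Φ t 0 * (1 - Q 0)‖ := norm_mul_le _ _
        _ ≤ (K * μ t ^ (-a) * μ t ^ (-θ)) * (K' * μ t ^ b') := by
            gcongr
            exact (norm_nonneg _).trans e1
        _ = K * K' * (μ t ^ (-a) * μ t ^ (-θ) * μ t ^ b') := by ring
        _ = K * K' * μ t ^ (b' - a - θ) := by
            rw [← Real.rpow_add (hμ.pos t), ← Real.rpow_add (hμ.pos t)]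
            ring_nf
    rw [mul_sub, mul_one, sub_eq_zero] at hz
    exact hz.symm

theorem IsSplitting.eq_of_zero_eq (hone : ∀ t s, Φ t s * Φ s t = 1)
    {P Q : ℝ → RMat d} {l r l' r' : ℝ} (h : IsSplitting μ Φ P l r)
    (h' : IsSplitting μ Φ Q l' r') (h0 : P 0 = Q 0) : P = Q := by
  funext t
  rw [← mul_one (P t), ← mul_one (Q t), ← hone t 0, ← mul_assoc, ← mul_assoc, h.2.1, h'.2.1, h0]

theorem IsSplitting.rank_le (hμ : IsGrowthRate μ) (hone : ∀ t s, Φ t s * Φ s t = 1)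
    {P Q : ℝ → RMat d} {l r l' r' : ℝ} (h : IsSplitting μ Φ P l r)
    (h' : IsSplitting μ Φ Q l' r') (hlr : l < r') : (P 0).rank ≤ (Q 0).rank := by
  rw [← (h.mul_eq hμ hone h' hlr).1]
  exact Matrix.rank_mul_le_left _ _

/-- The range of `P 0` lies in that of `Q 0`, so equal ranks give equal ranges. Then `P 0` fixes the
range of `Q 0`, whence `P 0 * Q 0 = Q 0`, while the ordering gives `P 0 * Q 0 = P 0`. -/
theorem IsSplitting.eq_of_rank_eq (hμ : IsGrowthRate μ) (hone : ∀ t s, Φ t s * Φ s t = 1)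
    {P Q : ℝ → RMat d} {l r l' r' : ℝ} (h : IsSplitting μ Φ P l r)
    (h' : IsSplitting μ Φ Q l' r') (hlr : l < r') (hrank : (P 0).rank = (Q 0).rank) : P = Q := by
  obtain ⟨hQP, hPQ⟩ := h.mul_eq hμ hone h' hlr
  refine h.eq_of_zero_eq hone h' ?_
  have hle : LinearMap.range (P 0).mulVecLin ≤ LinearMap.range (Q 0).mulVecLin := by
    rw [← hQP, Matrix.mulVecLin_mul]
    exact LinearMap.range_comp_le_range _ _
  have hrange := Submodule.eq_of_le_of_finrank_eq hle hrank
  rw [← hPQ]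
  refine Matrix.ext_of_mulVec_single fun i => ?_
  obtain ⟨x, hx⟩ : (Q 0) *ᵥ Pi.single i 1 ∈ LinearMap.range (P 0).mulVecLin :=
    hrange ▸ ⟨Pi.single i 1, rfl⟩
  rw [Matrix.mulVecLin_apply] at hx
  rw [← Matrix.mulVec_mulVec, ← hx, Matrix.mulVec_mulVec, h.1]

/-- Bounded growth yields the splitting by the identity far to the right. -/
theorem isSplitting_one (hμ : IsGrowthRate μ) {K a ϵ : ℝ} (hK : 1 ≤ K) (hϵ : 0 ≤ ϵ)
    (h : ∀ t s : ℝ, ‖Φ t s‖ ≤ K * (μ t / μ s) ^ (Real.sign (t - s) * a) *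
      μ s ^ (Real.sign s * ϵ)) (r : ℝ) : IsSplitting μ Φ (fun _ => 1) (a + ϵ) r := by
  refine ⟨fun _ => one_mul 1, fun t s => by rw [one_mul, mul_one], K, a, r, ϵ, 0, hK, hϵ, le_rfl,
    le_rfl, (sub_zero r).ge, fun t s hst => ?_, fun t s hst => ?_⟩
  · rw [mul_one]
    -- The diagonal is separate because `Real.sign 0 = 0` removes the exponent `a` there.
    rcases hst.eq_or_lt with rfl | hst
    · simpa only [div_self (hμ.pos s).ne', Real.one_rpow] using h s s
    · simpa only [Real.sign_of_pos (sub_pos.2 hst), one_mul] using h t s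
  · rw [sub_self, mul_zero, norm_zero]
    have := hμ.pos t
    have := hμ.pos s
    positivity

/-- Bounded growth yields the splitting by zero far to the left. -/
theorem isSplitting_zero (hμ : IsGrowthRate μ) {K a ϵ : ℝ} (hK : 1 ≤ K) (hϵ : 0 ≤ ϵ)
    (h : ∀ t s : ℝ, ‖Φ t s‖ ≤ K * (μ t / μ s) ^ (Real.sign (t - s) * a) *
      μ s ^ (Real.sign s * ϵ)) (l : ℝ) : IsSplitting μ Φ (fun _ => 0) l (-(a + ϵ)) := by
  refine ⟨fun _ => mul_zero 0, fun t s => by rw [zero_mul, mul_zero], K, l, -a, 0, ϵ, hK, le_rfl,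
    hϵ, (add_zero l).le, by linarith, fun t s hst => ?_, fun t s hst => ?_⟩
  · rw [mul_zero, norm_zero]
    have := hμ.pos t
    have := hμ.pos s
    positivity
  · rw [sub_zero, mul_one]
    rcases hst.eq_or_lt with rfl | hst
    · simpa only [div_self (hμ.pos t).ne', Real.one_rpow] using h t t
    · simpa only [Real.sign_of_neg (sub_neg.2 hst), neg_one_mul] using h t s

end Splitting

/-! ### Finite unions of compact intervals -/

/-- A set is a union of finitely many disjoint compact intervals if its complement carries a
monotone rank function that separates the components of the complement. -/
theorem exists_list_inter_Icc_eq {X : Set ℝ} (hX : IsClosed X) {r : ℝ → ℕ}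
    (hmono : ∀ x y, x ∉ X → y ∉ X → x ≤ y → r x ≤ r y)
    (heq : ∀ x y, x ∉ X → y ∉ X → x ≤ y → r x = r y → X ∩ Set.Icc x y = ∅) (N : ℕ) :
    ∀ lo hi, lo ∉ X → hi ∉ X → lo ≤ hi → r hi ≤ r lo + N →
      ∃ L : List (ℝ × ℝ), (∀ I ∈ L, I.1 ≤ I.2) ∧ L.Pairwise (fun I J => I.2 < J.1) ∧
        X ∩ Set.Icc lo hi = ⋃ I ∈ L, Set.Icc I.1 I.2 := by
  induction N using Nat.strong_induction_on with
  | _ N ih =>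
    intro lo hi hlo hhi hle hr
    by_cases hne : (X ∩ Set.Icc lo hi).Nonempty
    swap
    · exact ⟨[], by simp, by simp, by simpa using Set.not_nonempty_iff_eq_empty.1 hne⟩
    by_cases hconn : (X ∩ Set.Icc lo hi).OrdConnected
    · have hI := eq_Icc_of_connected_compact ⟨hne, hconn.isPreconnected⟩
        (isCompact_Icc.inter_left hX)
      refine ⟨[(sInf (X ∩ Set.Icc lo hi), sSup (X ∩ Set.Icc lo hi))], ?_, by simp, by simpa using hI⟩
      rw [hI] at hne
      simpa using Set.nonempty_Icc.1 hne
    -- A gap point `g` has points of `X` on both sides, so the rank strictly increases on each side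
    -- of it. Both halves then have a smaller rank increment, and the induction applies.
    · obtain ⟨x, hx, y, hy, g, hg, hgX⟩ : ∃ x ∈ X ∩ Set.Icc lo hi, ∃ y ∈ X ∩ Set.Icc lo hi,
          ∃ g ∈ Set.Icc x y, g ∉ X ∩ Set.Icc lo hi := by
        simpa only [Set.ordConnected_def, not_forall, Set.not_subset, exists_prop] using hconn
      have hlg : lo ≤ g := hx.2.1.trans hg.1
      have hgh : g ≤ hi := hg.2.trans hy.2.2
      have hg' : g ∉ X := fun h => hgX ⟨h, hlg, hgh⟩
      have h1 : r lo ≠ r g := fun h =>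
        (heq lo g hlo hg' hlg h).le ⟨hx.1, hx.2.1, hg.1⟩
      have h2 : r g ≠ r hi := fun h =>
        (heq g hi hg' hhi hgh h).le ⟨hy.1, hg.2, hy.2.2⟩
      have h3 := hmono lo g hlo hg' hlg
      have h4 := hmono g hi hg' hhi hgh
      obtain ⟨L₁, hL₁, hs₁, hu₁⟩ := ih (r g - r lo) (by omega) lo g hlo hg' hlg (by omega)
      obtain ⟨L₂, hL₂, hs₂, hu₂⟩ := ih (r hi - r g) (by omega) g hi hg' hhi hgh (by omega)
      refine ⟨L₁ ++ L₂, ?_, ?_, ?_⟩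
      · intro I hI
        exact (List.mem_append.1 hI).elim (hL₁ I) (hL₂ I)
      · refine List.pairwise_append.2 ⟨hs₁, hs₂, fun I hI J hJ => ?_⟩
        have hI' : I.2 ∈ X ∩ Set.Icc lo g :=
          hu₁ ▸ Set.mem_biUnion hI (Set.right_mem_Icc.2 (hL₁ I hI))
        have hJ' : J.1 ∈ X ∩ Set.Icc g hi :=
          hu₂ ▸ Set.mem_biUnion hJ (Set.left_mem_Icc.2 (hL₂ J hJ))
        exact (hI'.2.2.lt_of_ne fun h => hg' (h ▸ hI'.1)).trans_le hJ'.2.1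
      · rw [← Set.Icc_union_Icc_eq_Icc hlg hgh, Set.inter_union_distrib_left, hu₁, hu₂]
        ext z
        simp only [Set.mem_union, Set.mem_iUnion, List.mem_append, exists_prop, or_and_right,
          exists_or]

/-- `X` is the union of `n ≥ 1` disjoint compact intervals, listed increasingly. -/
def IsIntervalUnion (X : Set ℝ) : Prop :=
  ∃ (n : ℕ) (a b : Fin n → ℝ), 0 < n ∧ (∀ i, a i ≤ b i) ∧ (∀ i j, i < j → b i < a j) ∧
    X = ⋃ i, Set.Icc (a i) (b i)

theorem isIntervalUnion_of_list {X : Set ℝ} (hX : X.Nonempty) {L : List (ℝ × ℝ)}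
    (hL : ∀ I ∈ L, I.1 ≤ I.2) (hs : L.Pairwise (fun I J => I.2 < J.1))
    (hu : X = ⋃ I ∈ L, Set.Icc I.1 I.2) : IsIntervalUnion X := by
  refine ⟨L.length, fun i => (L.get i).1, fun i => (L.get i).2, ?_, fun i => hL _ (L.get_mem i),
    fun i j hij => List.pairwise_iff_get.1 hs i j hij, ?_⟩
  · refine List.length_pos_iff.2 fun h => ?_
    subst h
    simp at hu
    exact hX.ne_empty hu
  · rw [hu]
    ext z
    simp only [Set.mem_iUnion, exists_prop, List.mem_iff_get]
    constructor
    · rintro ⟨I, ⟨i, rfl⟩, hz⟩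
      exact ⟨i, hz⟩
    · rintro ⟨i, hz⟩
      exact ⟨_, ⟨i, rfl⟩, hz⟩

/-! ### Nonresonance under small enlargements -/

/-- An interval covered by well separated open intervals lies in one of them. -/
theorem exists_Icc_subset_Ioo {n : ℕ} {u v : Fin n → ℝ} (hsep : ∀ i j, i < j → v i < u j)
    {x y : ℝ} (hxy : x ≤ y) (hcov : ∀ z ∈ Set.Icc x y, ∃ i, u i < z ∧ z < v i) :
    ∃ i, u i < x ∧ y < v i := by
  obtain ⟨i, hix, hiv⟩ := hcov x (Set.left_mem_Icc.2 hxy)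
  refine ⟨i, hix, lt_of_not_ge fun hle => ?_⟩
  -- If the interval reached the endpoint `v i`, that point would need another covering interval,
  -- which separation forbids.
  obtain ⟨j, hju, hjv⟩ := hcov (v i) ⟨hiv.le, hle⟩
  rcases lt_trichotomy i j with h | rfl | h
  · exact (hsep i j h).not_gt hju
  · exact lt_irrefl _ hjv
  · exact ((hsep j i h).trans hix).not_gt (hiv.trans hjv)

theorem sum_fiber_mul {n m : ℕ} (c : Fin m → Fin n) (k : Fin m → ℕ) (f : Fin n → ℝ) :
    ∑ i, ((∑ q with c q = i, k q : ℕ) : ℝ) * f i = ∑ q, (k q : ℝ) * f (c q) := by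
  rw [← Finset.sum_fiberwise Finset.univ c]
  refine Finset.sum_congr rfl fun i _ => ?_
  rw [Nat.cast_sum, Finset.sum_mul]
  refine Finset.sum_congr rfl fun q hq => ?_
  rw [(Finset.mem_filter.1 hq).2]

/-- Nonresonance is inherited by the interval unions in a small neighbourhood. -/
theorem IsNonresonantUpTo.exists_thickening {p : ℕ} {X : Set ℝ} (hX : IsNonresonantUpTo p X) :
    ∃ δ > 0, ∀ Y ⊆ Metric.thickening δ X, IsIntervalUnion Y → IsNonresonantUpTo p Y := by
  obtain ⟨n, a, b, -, hab, hsep, rfl, hres⟩ := hX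
  have E1 : ∀ᶠ δ in 𝓝[>] (0 : ℝ), ∀ i j, i < j → b i + δ < a j - δ := by
    simp only [eventually_all]
    intro i j hij
    have h1 : Tendsto (fun δ : ℝ => b i + δ) (𝓝[>] 0) (𝓝 (b i + 0)) :=
      (Continuous.tendsto (by fun_prop) 0).mono_left nhdsWithin_le_nhds
    have h2 : Tendsto (fun δ : ℝ => a j - δ) (𝓝[>] 0) (𝓝 (a j - 0)) :=
      (Continuous.tendsto (by fun_prop) 0).mono_left nhdsWithin_le_nhds
    exact h1.eventually_lt h2 (by simpa using hsep i j hij)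
  -- Finitely many multi-indices occur, so one `δ` serves for all of them.
  have hfin : {k : Fin n → ℕ | ∑ i, k i ≤ p}.Finite :=
    (Set.finite_Iic (fun _ : Fin n => p)).subset fun k hk i =>
      (Finset.single_le_sum (fun _ _ => Nat.zero_le _) (Finset.mem_univ i)).trans hk
  have E2 : ∀ᶠ δ in 𝓝[>] (0 : ℝ), ∀ k ∈ {k : Fin n → ℕ | ∑ i, k i ≤ p}, ∀ j, 2 ≤ ∑ i, k i →
      (∑ i, (k i : ℝ) * (b i + δ) < a j - δ ∨ b j + δ < ∑ i, (k i : ℝ) * (a i - δ)) := by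
    rw [eventually_all_finite hfin]
    simp only [eventually_all]
    intro k hk j hk2
    have hdisj := hres j k hk2 hk
    have hle : ∑ i, (k i : ℝ) * a i ≤ ∑ i, (k i : ℝ) * b i :=
      Finset.sum_le_sum fun i _ => mul_le_mul_of_nonneg_left (hab i) (Nat.cast_nonneg _)
    have hcases : ∑ i, (k i : ℝ) * b i < a j ∨ b j < ∑ i, (k i : ℝ) * a i := by
      by_contra! h
      have hmem : max (a j) (∑ i, (k i : ℝ) * a i) ∈
          Set.Icc (a j) (b j) ∩ Set.Icc (∑ i, (k i : ℝ) * a i) (∑ i, (k i : ℝ) * b i) :=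
        ⟨⟨le_max_left _ _, max_le (hab j) h.2⟩, ⟨le_max_right _ _, max_le h.1 hle⟩⟩
      rw [hdisj] at hmem
      exact hmem
    refine hcases.elim (fun h => ?_) (fun h => ?_)
    · have h1 : Tendsto (fun δ : ℝ => ∑ i, (k i : ℝ) * (b i + δ)) (𝓝[>] 0)
          (𝓝 (∑ i, (k i : ℝ) * (b i + 0))) :=
        (Continuous.tendsto (by fun_prop) 0).mono_left nhdsWithin_le_nhds
      have h2 : Tendsto (fun δ : ℝ => a j - δ) (𝓝[>] 0) (𝓝 (a j - 0)) :=
        (Continuous.tendsto (by fun_prop) 0).mono_left nhdsWithin_le_nhds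
      exact (h1.eventually_lt h2 (by simpa using h)).mono fun _ => Or.inl
    · have h1 : Tendsto (fun δ : ℝ => ∑ i, (k i : ℝ) * (a i - δ)) (𝓝[>] 0)
          (𝓝 (∑ i, (k i : ℝ) * (a i - 0))) :=
        (Continuous.tendsto (by fun_prop) 0).mono_left nhdsWithin_le_nhds
      have h2 : Tendsto (fun δ : ℝ => b j + δ) (𝓝[>] 0) (𝓝 (b j + 0)) :=
        (Continuous.tendsto (by fun_prop) 0).mono_left nhdsWithin_le_nhds
      exact (h2.eventually_lt h1 (by simpa using h)).mono fun _ => Or.inr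
  obtain ⟨δ, ⟨hsepδ, hresδ⟩, hδ⟩ := ((E1.and E2).and self_mem_nhdsWithin).exists
  refine ⟨δ, hδ, ?_⟩
  rintro Y hY ⟨m, a', b', hm, hab', hsep', rfl⟩
  have hcov : ∀ q, ∀ z ∈ Set.Icc (a' q) (b' q), ∃ i, a i - δ < z ∧ z < b i + δ := by
    intro q z hz
    obtain ⟨x, hx, hzx⟩ := Metric.mem_thickening_iff.1 (hY (Set.mem_iUnion_of_mem q hz))
    obtain ⟨i, hi⟩ := Set.mem_iUnion.1 hx
    rw [Real.dist_eq, abs_lt] at hzx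
    exact ⟨i, by linarith [hi.1], by linarith [hi.2]⟩
  -- `c q` is the index of the enlarged interval containing the `q`-th component of `Y`; `c` need
  -- not be injective, so multiplicities are summed over its fibres.
  choose c hca hcb using fun q => exists_Icc_subset_Ioo hsepδ (hab' q) (hcov q)
  refine ⟨m, a', b', hm, hab', hsep', rfl, fun j k hk2 hkp => ?_⟩
  have hsum : ∑ i, ∑ q with c q = i, k q = ∑ q, k q := Finset.sum_fiberwise _ _ _
  have key := hresδ (fun i => ∑ q with c q = i, k q) (hsum.trans_le hkp) (c j) (hsum ▸ hk2)
  rw [sum_fiber_mul c k (fun i => b i + δ), sum_fiber_mul c k (fun i => a i - δ)] at key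
  have hb : ∑ q, (k q : ℝ) * b' q ≤ ∑ q, (k q : ℝ) * (b (c q) + δ) :=
    Finset.sum_le_sum fun q _ => mul_le_mul_of_nonneg_left (hcb q).le (Nat.cast_nonneg _)
  have ha : ∑ q, (k q : ℝ) * (a (c q) - δ) ≤ ∑ q, (k q : ℝ) * a' q :=
    Finset.sum_le_sum fun q _ => mul_le_mul_of_nonneg_left (hca q).le (Nat.cast_nonneg _)
  refine Set.eq_empty_of_forall_notMem fun z hz => ?_
  obtain ⟨⟨h1, h2⟩, h3, h4⟩ := hz
  have := hca j
  have := hcb j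
  rcases key with h | h <;> linarith

/-! ### The structure of the spectrum and its stability -/

section Spectrum

variable {d : ℕ} {μ : ℝ → ℝ} {Φ : ℝ → ℝ → RMat d} {A : ℝ → RMat d}

theorem IsDifferentiableGrowthRate.notMem_dichotomySpectrum_iff
    (hμ : IsDifferentiableGrowthRate μ) (hA : LocallyIntegrable A volume)
    (hΦ : IsEvolutionOperator A Φ) (γ : ℝ) :
    γ ∉ dichotomySpectrum μ A ↔ ∃ P l r, IsSplitting μ Φ P l r ∧ l < γ ∧ γ < r :=
  not_not.trans (hμ.hasNonuniformDichotomy_iff hA hΦ γ)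

theorem IsDifferentiableGrowthRate.isClosed_dichotomySpectrum
    (hμ : IsDifferentiableGrowthRate μ) (hA : LocallyIntegrable A volume)
    (hΦ : IsEvolutionOperator A Φ) : IsClosed (dichotomySpectrum μ A) := by
  refine isOpen_compl_iff.1 (isOpen_iff_mem_nhds.2 fun γ hγ => ?_)
  obtain ⟨P, l, r, h, hl, hr⟩ := (hμ.notMem_dichotomySpectrum_iff hA hΦ γ).1 hγ
  filter_upwards [Ioo_mem_nhds hl hr] with x hx
  exact (hμ.notMem_dichotomySpectrum_iff hA hΦ x).2 ⟨P, l, r, h, hx.1, hx.2⟩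

/-- The spectral theorem: if the identity and zero split the system far to the right and far to the
left, the spectrum is a nonempty finite union of compact intervals. -/
theorem IsDifferentiableGrowthRate.isIntervalUnion_dichotomySpectrum
    (hμ : IsDifferentiableGrowthRate μ) (hA : LocallyIntegrable A volume)
    (hΦ : IsEvolutionOperator A Φ) (hd : 0 < d) {m : ℝ}
    (h0 : ∀ l, IsSplitting μ Φ (fun _ => 0) l (-m))
    (h1 : ∀ r, IsSplitting μ Φ (fun _ => 1) m r) :
    IsIntervalUnion (dichotomySpectrum μ A) := by
  have hone : ∀ t s, Φ t s * Φ s t = 1 := fun t s => by rw [hΦ.mul hA, hΦ.self]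
  have hiff := hμ.notMem_dichotomySpectrum_iff hA hΦ
  -- The rank does not depend on the splitting around `γ`, since any two overlap at `γ` and the
  -- ordering applies both ways. On the spectrum the value `0` is a dummy.
  have hrk : ∀ γ, ∃ N : ℕ, ∀ P l r, IsSplitting μ Φ P l r → l < γ → γ < r → (P 0).rank = N := by
    intro γ
    by_cases h : γ ∈ dichotomySpectrum μ A
    · exact ⟨0, fun P l r hP hl hr => absurd h ((hiff γ).2 ⟨P, l, r, hP, hl, hr⟩)⟩
    · obtain ⟨Q, l', r', hQ, hl', hr'⟩ := (hiff γ).1 h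
      exact ⟨(Q 0).rank, fun P l r hP hl hr =>
        (hP.rank_le hμ.1 hone hQ (hl.trans hr')).antisymm
          (hQ.rank_le hμ.1 hone hP (hl'.trans hr))⟩
  choose rk hrk using hrk
  have hneg : ∀ γ, γ < -m → γ ∉ dichotomySpectrum μ A ∧ rk γ = 0 := fun γ hγ =>
    ⟨(hiff γ).2 ⟨_, _, _, h0 (γ - 1), sub_one_lt γ, hγ⟩, by
      rw [← hrk γ _ _ _ (h0 (γ - 1)) (sub_one_lt γ) hγ, Matrix.rank_zero]⟩
  have hpos : ∀ γ, m < γ → γ ∉ dichotomySpectrum μ A ∧ rk γ = d := fun γ hγ =>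
    ⟨(hiff γ).2 ⟨_, _, _, h1 (γ + 1), hγ, lt_add_one γ⟩, by
      rw [← hrk γ _ _ _ (h1 (γ + 1)) hγ (lt_add_one γ), Matrix.rank_one, Fintype.card_fin]⟩
  have hne : (dichotomySpectrum μ A).Nonempty := by
    rw [Set.nonempty_iff_ne_empty]
    intro hempty
    -- With empty spectrum the rank would be constant on the connected line, forcing `0 = d`.
    have hconst : IsLocallyConstant rk := by
      refine (IsLocallyConstant.iff_eventually_eq rk).2 fun γ => ?_
      obtain ⟨P, l, r, hP, hl, hr⟩ := (hiff γ).1 (hempty ▸ Set.notMem_empty γ)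
      filter_upwards [Ioo_mem_nhds hl hr] with x hx
      rw [← hrk x P l r hP hx.1 hx.2, hrk γ P l r hP hl hr]
    have := hconst.apply_eq_of_preconnectedSpace (-m - 1) (m + 1)
    rw [(hneg _ (sub_one_lt _)).2, (hpos _ (lt_add_one _)).2] at this
    omega
  have hmono : ∀ x y, x ∉ dichotomySpectrum μ A → y ∉ dichotomySpectrum μ A → x ≤ y →
      rk x ≤ rk y := by
    intro x y hx hy hxy
    obtain ⟨P, l, r, hP, hl, hr⟩ := (hiff x).1 hx
    obtain ⟨Q, l', r', hQ, hl', hr'⟩ := (hiff y).1 hy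
    rw [← hrk x P l r hP hl hr, ← hrk y Q l' r' hQ hl' hr']
    exact hP.rank_le hμ.1 hone hQ (hl.trans (hxy.trans_lt hr'))
  have heq : ∀ x y, x ∉ dichotomySpectrum μ A → y ∉ dichotomySpectrum μ A → x ≤ y →
      rk x = rk y → dichotomySpectrum μ A ∩ Set.Icc x y = ∅ := by
    intro x y hx hy hxy hr_eq
    obtain ⟨P, l, r, hP, hl, hr⟩ := (hiff x).1 hx
    obtain ⟨Q, l', r', hQ, hl', hr'⟩ := (hiff y).1 hy
    rw [← hrk x P l r hP hl hr, ← hrk y Q l' r' hQ hl' hr'] at hr_eq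
    -- Equal ranks give the same projections, so the two intervals glue to one covering `[x, y]`.
    obtain rfl := hP.eq_of_rank_eq hμ.1 hone hQ (hl.trans (hxy.trans_lt hr')) hr_eq
    refine Set.eq_empty_of_forall_notMem fun z hz => (hiff z).2 ?_ hz.1
    exact ⟨P, l, r', hP.glue hμ.1 hQ, hl.trans_le hz.2.1, hz.2.2.trans_lt hr'⟩
  have hsub : dichotomySpectrum μ A ⊆ Set.Icc (-|m| - 1) (|m| + 1) := by
    intro z hz
    have h2 := le_of_not_gt fun h => (hneg z h).1 hz
    have h3 := le_of_not_gt fun h => (hpos z h).1 hz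
    exact ⟨by linarith [le_abs_self m], by linarith [le_abs_self m]⟩
  obtain ⟨L, hL, hs, hu⟩ := exists_list_inter_Icc_eq (hμ.isClosed_dichotomySpectrum hA hΦ)
    hmono heq d (-|m| - 1) (|m| + 1)
    (hneg _ (by linarith [le_abs_self m])).1 (hpos _ (by linarith [le_abs_self m])).1
    (by linarith [abs_nonneg m])
    (by rw [(hpos (|m| + 1) (by linarith [le_abs_self m])).2]; omega)
  rw [Set.inter_eq_left.2 hsub] at hu
  exact isIntervalUnion_of_list hne hL hs hu

/-- Away from the spectrum, the intervals of the splittings have a uniform margin. -/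
theorem IsDifferentiableGrowthRate.exists_splitting_margin
    (hμ : IsDifferentiableGrowthRate μ) (hA : LocallyIntegrable A volume)
    (hΦ : IsEvolutionOperator A Φ) {m : ℝ}
    (h0 : ∀ l, IsSplitting μ Φ (fun _ => 0) l (-m))
    (h1 : ∀ r, IsSplitting μ Φ (fun _ => 1) m r) {δ : ℝ} (hδ : 0 < δ) :
    ∃ ε > 0, ∀ γ ∉ Metric.thickening δ (dichotomySpectrum μ A),
      ∃ P l r, IsSplitting μ Φ P l r ∧ l + 3 * ε < γ ∧ γ < r - 3 * ε := by
  set K := Set.Icc (-(m + 1)) (m + 1) \ Metric.thickening δ (dichotomySpectrum μ A)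
  have hK : IsCompact K := isCompact_Icc.diff Metric.isOpen_thickening
  obtain ⟨ε₀, hε₀, hε₀K⟩ : ∃ ε₀ > 0, ∀ ε ≤ ε₀, ∀ γ ∈ K,
      ∃ P l r, IsSplitting μ Φ P l r ∧ l + 3 * ε < γ ∧ γ < r - 3 * ε := by
    -- The local margin is uniform near each point, and asking it for all `ε ≤ ε₀` makes it stable
    -- under finite unions.
    refine hK.induction_on (p := fun s => ∃ ε₀ > 0, ∀ ε ≤ ε₀, ∀ γ ∈ s,
      ∃ P l r, IsSplitting μ Φ P l r ∧ l + 3 * ε < γ ∧ γ < r - 3 * ε)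
      ⟨1, one_pos, by simp⟩ ?_ ?_ ?_
    · rintro s t hst ⟨ε₀, hε₀, h⟩
      exact ⟨ε₀, hε₀, fun ε hε γ hγ => h ε hε γ (hst hγ)⟩
    · rintro s t ⟨ε₁, hε₁, hs⟩ ⟨ε₂, hε₂, ht⟩
      refine ⟨min ε₁ ε₂, lt_min hε₁ hε₂, fun ε hε γ hγ => hγ.elim ?_ ?_⟩
      · exact hs ε (hε.trans (min_le_left _ _)) γ
      · exact ht ε (hε.trans (min_le_right _ _)) γ
    · intro γ hγ
      obtain ⟨P, l, r, hP, hl, hr⟩ := (hμ.notMem_dichotomySpectrum_iff hA hΦ γ).1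
        fun h => hγ.2 (Metric.self_subset_thickening hδ _ h)
      obtain ⟨x, hlx, hxγ⟩ := exists_between hl
      obtain ⟨y, hγy, hyr⟩ := exists_between hr
      refine ⟨Set.Ioo x y, mem_nhdsWithin_of_mem_nhds (Ioo_mem_nhds hxγ hγy),
        min ((x - l) / 3) ((r - y) / 3), by
          apply lt_min <;> linarith, fun ε hε z hz => ⟨P, l, r, hP, ?_, ?_⟩⟩
      · linarith [hz.1, hε.trans (min_le_left _ _)]
      · linarith [hz.2, hε.trans (min_le_right _ _)]
  -- With `3 * ε ≤ 1`, the growth splittings by `0` and `1` handle every `γ` outside `[-(m + 1), m +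
  -- 1]`.
  refine ⟨min ε₀ (1 / 3), by positivity, fun γ hγ => ?_⟩
  have hmin := min_le_right ε₀ (1 / 3 : ℝ)
  by_cases h2 : m + 1 < γ
  · exact ⟨_, _, _, h1 (γ + 2), by linarith, by linarith⟩
  by_cases h3 : γ < -(m + 1)
  · exact ⟨_, _, _, h0 (γ - 2), by linarith, by linarith⟩
  · exact hε₀K _ (min_le_left _ _) γ ⟨⟨not_lt.1 h3, not_lt.1 h2⟩, hγ⟩

end Spectrum

theorem mainTheorem10 {d : ℕ} (μ : ℝ → ℝ) (hμ : IsDifferentiableGrowthRate μ)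
    (A : ℝ → RMat d) (hA : LocallyIntegrable A volume)
    (ϵ : ℝ) (hϵ : 0 ≤ ϵ) (hgrowth : HasNonuniformGrowth μ ϵ A)
    (p : ℕ) (hres : IsNonresonantUpTo p (dichotomySpectrum μ A)) :
    ∃ ε : ℝ, 0 < ε ∧
      ∀ B : ℝ → RMat d, LocallyIntegrable B volume → KinematicallySimilar μ ε A B →
        IsNonresonantUpTo p (dichotomySpectrum μ B) := by
  obtain ⟨Φ, hΦ, K, a, hK, -, hgr⟩ := hgrowth
  have h0 := isSplitting_zero hμ.1 hK hϵ hgr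
  have h1 := isSplitting_one hμ.1 hK hϵ hgr
  -- In dimension `0` the projections `0` and `1` coincide, so their splittings glue and the
  -- spectrum is empty, whereas nonresonance supplies at least one interval.
  have hd : 0 < d := by
    obtain ⟨n, u, v, hn, huv, -, hX, -⟩ := hres
    have hmem : u ⟨0, hn⟩ ∈ dichotomySpectrum μ A := by
      rw [hX]
      exact Set.mem_iUnion_of_mem _ (Set.left_mem_Icc.2 (huv _))
    refine Nat.pos_of_ne_zero fun hd => ?_
    subst hd
    exact (hμ.notMem_dichotomySpectrum_iff hA hΦ _).2 ⟨fun _ => 0, _, _, (h0 _).glue hμ.1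
      (Subsingleton.elim (fun _ => (1 : RMat 0)) (fun _ => 0) ▸ h1 _), sub_one_lt _,
      lt_add_one _⟩ hmem
  obtain ⟨δ, hδ, hstable⟩ := hres.exists_thickening
  obtain ⟨ε, hε, hmargin⟩ := hμ.exists_splitting_margin hA hΦ h0 h1 hδ
  refine ⟨ε, hε, fun B hB hAB => ?_⟩
  obtain ⟨M, S, -, -, hS, hS', hAtoB, -⟩ := hAB
  have hΨ := hΦ.conj S hAtoB
  refine hstable _ (fun γ hγ => ?_) ?_
  · by_contra hγ'
    obtain ⟨P, l, r, hP, hl, hr⟩ := hmargin γ hγ'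
    exact (hμ.notMem_dichotomySpectrum_iff hB hΨ γ).2
      ⟨_, _, _, hP.conj hμ.1 hε.le S hS hS', hl, hr⟩ hγ
  -- The trivial splittings of `B` are those of `A` conjugated, which costs `3 * ε` in the bound
  -- `m`; the free endpoint is shifted beforehand to absorb the same loss.
  · refine hμ.isIntervalUnion_dichotomySpectrum hB hΨ hd (m := a + ϵ + 3 * ε) (fun l => ?_)
      fun r => ?_
    · have := (h0 (l - 3 * ε)).conj hμ.1 hε.le S hS hS'
      simpa only [mul_zero, zero_mul, sub_add_cancel, neg_add, ← sub_eq_add_neg] using this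
    · have := (h1 (r + 3 * ε)).conj hμ.1 hε.le S hS hS'
      simpa only [mul_one, Units.inv_mul, add_sub_cancel_right] using this
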